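/- **Setting.** Let $M$ be a finite set of agents (write $M$ also for their number). A fixed-action-set linear bandit instance $I$ consists of a parameter $\theta^*\in\mathbb{R}^d$, a non-empty finite action set $X\subset\mathbb{R}^d$, $|X|=K$, available to every agent at every time, and a zero-mean sub-Gaussian noise law: an agent $a$ who plays $x\in X$ at time $t$ observes $\langle\theta^*,x\rangle+\eta_{a,t}$, the $\eta_{a,t}$ being i.i.d. with that law. Let $\Delta=\max_{x\in X}\bigl(\max_{x'\in X}\langle\theta^*,x'\rangle-\langle\theta^*,x\rangle\bigr)$ be the largest sub-optimality gap. Let $\mathrm{Sin}$ be a (possibly randomized) single-agent bandit algorithm on $X$, i.e. a rule that chooses the next action from the history of its actions and rewards, and let $R(t)$ be its expected pseudo-regret on $I$ after $t$ steps, i.e. $R(t)=\sum_{s=1}^{t}\bigl(\max_{x\in X}\langle\theta^*,x\rangle-\mathbb{E}\langle\theta^*,x_s\rangle\bigr)$. For a coalition $C\subseteq M$ the multi-agent algorithm $\mathrm{Mul}$ runs as follows. It keeps a reward buffer $B_x$ for every $x\in X$ (initially empty) and a simulated history of $\mathrm{Sin}$ (initially empty); let $\bar x$ be the first action of $\mathrm{Sin}$.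 At each time $t=1,\dots,T$ all agents of $C$ play $\bar x$, and $B_{\bar x}$ is replaced by the rewards they observe; then, as long as $B_{\bar x}\neq\emptyset$, one reward is removed from $B_{\bar x}$ (by an arbitrary rule that does not look at the reward values), the pair of $\bar x$ and that reward is appended to the simulated history, and $\bar x$ becomes the next action of $\mathrm{Sin}$ on that history. Let $R^C_a(\mathrm{Mul},I,T)=\sum_{t=1}^{T}\bigl(\max_{x\in X}\langle\theta^*,x\rangle-\mathbb{E}\langle\theta^*,x_{a,t}\rangle\bigr)$ be the expected regret of $a\in C$, and let $v(C)=v_{\mathrm{Mul},I,T}(C)=-\sum_{a\in C}R^C_a(\mathrm{Mul},I,T)$. For integers $t\ge 0$ and $g,h\ge 1$ put $R'(t,h)=\frac{R(t+h)-R(t)}{h}$ and $R''(t,g,h)=\frac{R'(t+g,h)-R'(t,h)}{g}$. **Corollary.** Let $T\ge 0$ be a time horizon. Suppose that there are numbers $\upsilon_t>0$ ($0\le t\le MT-2$), $c\in\mathbb{R}$ and $\varepsilon>0$ such that, for all integers $t\ge0$, $g,h\ge1$ with $t+g+h\le MT$, $$R''(t,g,h)\le-\upsilon_t\qquad\text{and,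 if } t\ge 1,\qquad R''(t,g,h)\ge -c\,t^{-2+\varepsilon},$$ and that $T$ is sufficiently large in the sense that $$T\;\ge\;\sqrt{\frac{4MK\Delta}{\upsilon_t}}\qquad\text{for all } 0\le t\le MT-2 .$$ Then the core of the collaboration game $(M,v_{\mathrm{Mul},I,T})$, i.e. $\{p\in\mathbb{R}^M:\sum_{i\in M}p_i=v(M),\ \sum_{i\in C}p_i\ge v(C)\ \text{for all } C\subseteq M\}$, is non-empty, and the Shapley value $$\phi_i(v)=\frac1M\sum_{S\subseteq M\setminus\{i\}}\binom{M-1}{|S|}^{-1}\bigl(v(S\cup\{i\})-v(S)\bigr),\qquad i\in M,$$ lies in the core. -/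

import Mathlib

open MeasureTheory ProbabilityTheory

noncomputable section

/-! ### Cooperative games with transferable utility -/

/-- The core of the TU game with player set `A` and value function `v`. -/
def core {A : Type*} [Fintype A] (v : Finset A → ℝ) : Set (A → ℝ) :=
  {p | ∑ i, p i = v Finset.univ ∧ ∀ C : Finset A, v C ≤ ∑ i ∈ C, p i}

open Classical in
/-- The Shapley value of the TU game with player set `A` and value function `v`. -/
def shapleyValue {A : Type*} [Fintype A] (v : Finset A → ℝ) (i : A) : ℝ :=
  (1 / (Fintype.card A : ℝ)) *
    ∑ S ∈ (Finset.univ.erase i).powerset,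
      ((Nat.choose (Fintype.card A - 1) S.card : ℝ))⁻¹ * (v (insert i S) - v S)

/-! ### Linear bandit instances with a fixed action set -/

/-- A linear bandit instance in which every agent has the same finite action set at every time.
The reward of an action `x` is `⟪θ, x⟫` plus a noise term of law `noise`; the noise terms of all
agents and times are independent. -/
structure FixedInstance (d : ℕ) where
  /-- the unknown model parameter -/
  θ : EuclideanSpace ℝ (Fin d)
  /-- the common action set -/
  X : Finset (EuclideanSpace ℝ (Fin d))
  X_nonempty : X.Nonempty
  /-- the common law of the noise terms -/
  noise : Measure ℝ
  isProbabilityMeasure_noise : IsProbabilityMeasure noise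
  noise_mean_zero : ∫ η, η ∂noise = 0
  noise_subgaussian : ∃ σ2 : NNReal, HasSubgaussianMGF id σ2 noise

namespace FixedInstance

variable {d : ℕ} (I : FixedInstance d)

instance : IsProbabilityMeasure I.noise := I.isProbabilityMeasure_noise

/-- The expected reward of an action. -/
def meanReward (x : EuclideanSpace ℝ (Fin d)) : ℝ := inner ℝ I.θ x

/-- The expected reward of an optimal action. -/
def optReward : ℝ := I.X.sup' I.X_nonempty I.meanReward

/-- The largest sub-optimality gap of an action. -/
def maxGap : ℝ := I.X.sup' I.X_nonempty fun x => I.optReward - I.meanReward x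

end FixedInstance

/-! ### Single-agent algorithms -/

/-- A (possibly randomized) single-agent bandit algorithm for the finite action set `X`. Its
internal randomness is a random seed, drawn before play starts and independent of the rewards; the
next action is a function of the seed and of the history of actions and rewards, listed in
chronological order. -/
structure SingleAgentAlgorithm {d : ℕ} (X : Finset (EuclideanSpace ℝ (Fin d))) where
  Seed : Type*
  measurableSpaceSeed : MeasurableSpace Seed
  seedLaw : Measure Seed
  isProbabilityMeasure_seedLaw : IsProbabilityMeasure seedLaw
  act : Seed → List (X × ℝ) → X
  measurable_act : ∀ n : ℕ,
    Measurable fun p : Seed × (Fin n → X × ℝ) => act p.1 (List.ofFn p.2)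

namespace SingleAgentAlgorithm

variable {d : ℕ} {X : Finset (EuclideanSpace ℝ (Fin d))} (Sin : SingleAgentAlgorithm X)

instance : MeasurableSpace Sin.Seed := Sin.measurableSpaceSeed

instance : IsProbabilityMeasure Sin.seedLaw := Sin.isProbabilityMeasure_seedLaw

end SingleAgentAlgorithm

/-- The history of the first `t` steps of a run of the single-agent algorithm `Sin` on the
instance `I`, for a given seed `ω` and given noise terms `η`. -/
def singleHistory {d : ℕ} (I : FixedInstance d) (Sin : SingleAgentAlgorithm I.X)
    (ω : Sin.Seed) (η : ℕ → ℝ) : ℕ → List (I.X × ℝ)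
  | 0 => []
  | t + 1 =>
    let h := singleHistory I Sin ω η t
    let x := Sin.act ω h
    h ++ [(x, I.meanReward x + η t)]

/-- The expected (pseudo-)regret of the single-agent algorithm `Sin` over `T` steps. -/
def singleRegret {d : ℕ} (I : FixedInstance d) (Sin : SingleAgentAlgorithm I.X) (T : ℕ) : ℝ :=
  ∑ t ∈ Finset.range T,
    (I.optReward - ∫ p : Sin.Seed × (ℕ → ℝ),
      I.meanReward (Sin.act p.1 (singleHistory I Sin p.1 p.2 t))
        ∂(Sin.seedLaw.prod (Measure.infinitePi fun _ : ℕ => I.noise)))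

/-! ### Multi-agent algorithms, regret and the collaboration game -/

/-- A (possibly randomized) multi-agent algorithm for the agents `A` and the finite action set `X`.
For every coalition `C`, the profile of actions to be played next by the agents in `C` is a function
of the seed and of the coalition history, that is, the chronological list of the actions played and
the rewards observed by all agents in `C`. -/
structure MultiAgentAlgorithm {d : ℕ} (A : Type*) (X : Finset (EuclideanSpace ℝ (Fin d))) where
  Seed : Type*
  measurableSpaceSeed : MeasurableSpace Seed
  seedLaw : Measure Seed
  isProbabilityMeasure_seedLaw : IsProbabilityMeasure seedLaw
  act : (C : Finset A) → Seed → List (C → X × ℝ) → C → X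

namespace MultiAgentAlgorithm

variable {d : ℕ} {A : Type*} {X : Finset (EuclideanSpace ℝ (Fin d))} (Alg : MultiAgentAlgorithm A X)

instance : MeasurableSpace Alg.Seed := Alg.measurableSpaceSeed

instance : IsProbabilityMeasure Alg.seedLaw := Alg.isProbabilityMeasure_seedLaw

end MultiAgentAlgorithm

/-- The history of the coalition `C` after `t` time-steps of a run of `Alg` on the instance `I`,
for a given seed `ω` and given noise terms `η (a, s)` of agent `a` at time `s`. -/
def coalitionHistory {d : ℕ} {A : Type*} (I : FixedInstance d) (Alg : MultiAgentAlgorithm A I.X)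
    (C : Finset A) (ω : Alg.Seed) (η : A × ℕ → ℝ) : ℕ → List (C → I.X × ℝ)
  | 0 => []
  | t + 1 =>
    let H := coalitionHistory I Alg C ω η t
    let x := Alg.act C ω H
    H ++ [fun a => (x a, I.meanReward (x a) + η (a, t))]

/-- The expected (pseudo-)regret of agent `a` of the coalition `C` over `T` time-steps. -/
def regret {d : ℕ} {A : Type*} (I : FixedInstance d) (Alg : MultiAgentAlgorithm A I.X)
    (C : Finset A) (a : C) (T : ℕ) : ℝ :=
  ∑ t ∈ Finset.range T,
    (I.optReward - ∫ p : Alg.Seed × (A × ℕ → ℝ),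
      I.meanReward (Alg.act C p.1 (coalitionHistory I Alg C p.1 p.2 t) a)
        ∂(Alg.seedLaw.prod (Measure.infinitePi fun _ : A × ℕ => I.noise)))

/-- The value function of the collaboration game: minus the total regret of a coalition. -/
def collaborationValue {d : ℕ} {A : Type*} (I : FixedInstance d) (Alg : MultiAgentAlgorithm A I.X)
    (T : ℕ) (C : Finset A) : ℝ :=
  -∑ a : C, regret I Alg C a T

/-! ### The meta-algorithm -/

/-- The rule by which the meta-algorithm removes a reward from a non-empty buffer: when coalition
`C` reads at the given step from the buffer of the given action, and `s` is the set of the agents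
whose rewards are still in that buffer, it names the agent whose reward is removed. The choice is
arbitrary, but made without looking at the rewards. -/
abbrev RemovalRule {d : ℕ} (A : Type*) (X : Finset (EuclideanSpace ℝ (Fin d))) :=
  (C : Finset A) → ℕ → X → (s : Finset C) → s.Nonempty → {a : C // a ∈ s}

/-- The internal state of the meta-algorithm. The buffer of the action `x` consists of the rewards
`reward x a` for `a ∈ avail x`. -/
structure MulState {d : ℕ} {A : Type*} (X : Finset (EuclideanSpace ℝ (Fin d))) (C : Finset A) where
  avail : X → Finset C
  reward : X → C → ℝ
  /-- the history of the simulated single-agent play -/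
  hist : List (X × ℝ)
  /-- the next action of the simulated single-agent play -/
  cur : X

section Mul

variable {d : ℕ} {A : Type*} {X : Finset (EuclideanSpace ℝ (Fin d))}

/-- Empty buffers, empty simulated history, and the first action of `Sin`. -/
def mulInit (Sin : SingleAgentAlgorithm X) (C : Finset A) (ω : Sin.Seed) : MulState X C where
  avail := fun _ => ∅
  reward := fun _ _ => 0
  hist := []
  cur := Sin.act ω []

open Classical in
/-- Replace the content of the buffer of the current action by the new rewards of all agents. -/
def mulReplenish {C : Finset A} (s : MulState X C) (y : C → ℝ) : MulState X C :=
  { s with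
    avail := Function.update s.avail s.cur Finset.univ
    reward := Function.update s.reward s.cur y }

open Classical in
/-- One pass of the inner loop: if the buffer of the current action is non-empty, remove a reward
from it, append it to the simulated history, and get the next action from `Sin`; otherwise do
nothing. -/
def mulRead (Sin : SingleAgentAlgorithm X) (ρ : RemovalRule A X) {C : Finset A} (ω : Sin.Seed)
    (s : MulState X C) : MulState X C :=
  if hs : (s.avail s.cur).Nonempty then
    let a : C := (ρ C s.hist.length s.cur (s.avail s.cur) hs).1
    let h := s.hist ++ [(s.cur, s.reward s.cur a)]
    { avail := Function.update s.avail s.cur ((s.avail s.cur).erase a)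
      reward := s.reward
      hist := h
      cur := Sin.act ω h }
  else s

/-- The total number of rewards in the buffers. -/
def mulBufferSize {C : Finset A} (s : MulState X C) : ℕ := ∑ x, (s.avail x).card

/-- The inner loop: read until the buffer of the current action is empty. Every reading removes a
reward, so that the loop ends after at most `mulBufferSize s` readings. -/
def mulDrain (Sin : SingleAgentAlgorithm X) (ρ : RemovalRule A X) {C : Finset A} (ω : Sin.Seed)
    (s : MulState X C) : MulState X C :=
  (mulRead Sin ρ ω)^[mulBufferSize s] s

theorem mulRead_of_nonempty (Sin : SingleAgentAlgorithm X) (ρ : RemovalRule A X) {C : Finset A}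
    (ω : Sin.Seed) (s : MulState X C) (hs : (s.avail s.cur).Nonempty) :
    mulBufferSize (mulRead Sin ρ ω s) + 1 = mulBufferSize s := by
  classical
  have hmem := (ρ C s.hist.length s.cur (s.avail s.cur) hs).2
  have hcard := Finset.card_erase_add_one hmem
  simp only [mulBufferSize, mulRead, hs, dif_pos]
  rw [← Finset.add_sum_erase _ _ (Finset.mem_univ s.cur),
    ← Finset.add_sum_erase _ (fun x => (s.avail x).card) (Finset.mem_univ s.cur)]
  have hrest : ∀ x ∈ Finset.univ.erase s.cur,
      ((Function.update s.avail s.cur ((s.avail s.cur).erase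
        (ρ C s.hist.length s.cur (s.avail s.cur) hs).1)) x).card = (s.avail x).card := by
    intro x hx
    rw [Function.update_of_ne (Finset.ne_of_mem_erase hx)]
  rw [Finset.sum_congr rfl hrest, Function.update_self, ← hcard]
  convert Nat.add_right_comm _ _ _ using 3

/-- The inner loop does end with an empty buffer of the current action. -/
theorem mulDrain_avail_cur (Sin : SingleAgentAlgorithm X) (ρ : RemovalRule A X) {C : Finset A}
    (ω : Sin.Seed) (s : MulState X C) :
    (mulDrain Sin ρ ω s).avail (mulDrain Sin ρ ω s).cur = ∅ := by
  suffices H : ∀ n (s : MulState X C), mulBufferSize s = n →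
      ((mulRead Sin ρ ω)^[n] s).avail ((mulRead Sin ρ ω)^[n] s).cur = ∅ from H _ s rfl
  intro n
  induction n with
  | zero =>
    intro s hs
    have h := (Finset.sum_eq_zero_iff.mp hs) s.cur (Finset.mem_univ _)
    exact Finset.card_eq_zero.mp h
  | succ n ih =>
    intro s hs
    rw [Function.iterate_succ_apply]
    by_cases hne : (s.avail s.cur).Nonempty
    · exact ih _ (by have := mulRead_of_nonempty Sin ρ ω s hne; omega)
    · have hfix : mulRead Sin ρ ω s = s := by simp [mulRead, hne]
      rw [hfix, Function.iterate_fixed hfix]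
      exact Finset.not_nonempty_iff_eq_empty.mp hne

/-- The state of the meta-algorithm after it has processed a coalition history. -/
def mulState (Sin : SingleAgentAlgorithm X) (ρ : RemovalRule A X) (C : Finset A) (ω : Sin.Seed)
    (H : List (C → X × ℝ)) : MulState X C :=
  H.foldl (fun s r => mulDrain Sin ρ ω (mulReplenish s fun a => (r a).2)) (mulInit Sin C ω)

/-- The multi-agent meta-algorithm built on the single-agent algorithm `Sin`: every agent of the
coalition plays the current action of the simulated single-agent play. -/
def mulAlgorithm (Sin : SingleAgentAlgorithm X) (ρ : RemovalRule A X) : MultiAgentAlgorithm A X where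
  Seed := Sin.Seed
  measurableSpaceSeed := Sin.measurableSpaceSeed
  seedLaw := Sin.seedLaw
  isProbabilityMeasure_seedLaw := Sin.isProbabilityMeasure_seedLaw
  act := fun C ω H _ => (mulState Sin ρ C ω H).cur

end Mul

/-! ### The assumption on the regret of the single-agent algorithm -/

/-- The discrete first derivative `R'(t, h)`. -/
def discreteDeriv (R : ℕ → ℝ) (t h : ℕ) : ℝ := (R (t + h) - R t) / h

/-- The discrete second derivative `R''(t, g, h)`. -/
def discreteDeriv₂ (R : ℕ → ℝ) (t g h : ℕ) : ℝ :=
  (discreteDeriv R (t + g) h - discreteDeriv R t h) / g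

/-- The assumption on the regret curve `R`, up to time `N`: strict concavity, quantified by the
positive numbers `υ t`, and the logarithmic limitation with constants `c` and `ε`. -/
structure RegretRate (R : ℕ → ℝ) (N : ℕ) (υ : ℕ → ℝ) (c ε : ℝ) : Prop where
  υ_pos : ∀ t : ℕ, t + 2 ≤ N → 0 < υ t
  ε_pos : 0 < ε
  strict_concavity : ∀ t g h : ℕ, 0 < g → 0 < h → t + g + h ≤ N →
    discreteDeriv₂ R t g h ≤ -υ t
  logarithmic_limitation : ∀ t g h : ℕ, 0 < t → 0 < g → 0 < h → t + g + h ≤ N →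
    -c * (t : ℝ) ^ (-2 + ε) ≤ discreteDeriv₂ R t g h

end

/-!
Since the removal rule does not look at the rewards, which noise term enters a step of the simulated
play is determined by the seed and the rewards that entered the earlier steps, and no noise term
enters twice. Reading an i.i.d. family in such an adaptive order yields an i.i.d. sequence, so the
simulated play has the law of a run of `Sin`.

In `T` time-steps a coalition of `k` agents earns `kT` rewards. All of them are read by the
simulated play except those left in the buffers, at most `k * min K T`; hence the value of the
coalition is `-R(kT)` up to an error `k * min K T * Δ`. In a mixed second difference of the value
these errors add up to at most `4(k + 1) * min K T * Δ`, which the strict concavity of `R` at the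
points `kT`, `(k + 1)T` and `(k + 2)T` absorbs. The game is therefore convex, and the Shapley value
of a convex game lies in the core: for players in `C`, it dominates the Shapley value of the game
`S ↦ v (S ∩ C)`, whose total is `v C`.
-/

noncomputable section

/-! ### Convex games -/

section Games

variable {A : Type*}

section Shapley

variable [Fintype A]

/-- Regroups a weighted sum of marginal contributions by coalition: `v S` occurs positively as
`v (insert i (S.erase i))` for `i ∈ S` and negatively for `i ∉ S`. -/
theorem sum_sum_weight_mul_marginal [DecidableEq A] (w : ℕ → ℝ) (v : Finset A → ℝ) :
    ∑ i, ∑ S ∈ (Finset.univ.erase i).powerset, w S.card * (v (insert i S) - v S) =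
      ∑ S : Finset A,
        (S.card * w (S.card - 1) - (Fintype.card A - S.card : ℕ) * w S.card) * v S := by
  have hmarginal (i : A) :
      ∑ S ∈ (Finset.univ.erase i).powerset, w S.card * (v (insert i S) - v S) =
        ∑ S : Finset A, if i ∈ S then w (S.card - 1) * v S else -(w S.card * v S) := by
    rw [← Finset.powerset_univ, ← Finset.insert_erase (Finset.mem_univ i),
      Finset.sum_powerset_insert (Finset.notMem_erase i _), ← Finset.sum_add_distrib,
      Finset.erase_insert (Finset.notMem_erase i _)]
    refine Finset.sum_congr rfl fun S hS => ?_
    have hi : i ∉ S := fun h => Finset.notMem_erase i _ (Finset.mem_powerset.mp hS h)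
    simp only [hi, if_false, Finset.mem_insert_self, if_true, Finset.card_insert_of_notMem hi,
      Nat.add_sub_cancel]
    ring
  simp only [hmarginal]
  rw [Finset.sum_comm]
  refine Finset.sum_congr rfl fun S _ => ?_
  rw [Finset.sum_ite, Finset.sum_const, Finset.sum_const, Finset.filter_mem_eq_inter,
    Finset.univ_inter, Finset.filter_notMem_eq_sdiff, ← Finset.compl_eq_univ_sdiff,
    Finset.card_compl, nsmul_eq_mul, nsmul_eq_mul]
  ring

theorem mul_inv_choose_pred_eq_mul_inv_choose {m k : ℕ} (hk : 0 < k) (hkm : k ≤ m) :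
    (k : ℝ) * (m.choose (k - 1) : ℝ)⁻¹ = (m + 1 - k : ℕ) * (m.choose k : ℝ)⁻¹ := by
  obtain ⟨j, rfl⟩ := Nat.exists_eq_succ_of_ne_zero hk.ne'
  have hpred : (m.choose j : ℝ) ≠ 0 := by exact_mod_cast (Nat.choose_pos (by omega)).ne'
  have hsucc : (m.choose (j + 1) : ℝ) ≠ 0 := by exact_mod_cast (Nat.choose_pos hkm).ne'
  have hrec : (m.choose (j + 1) : ℝ) * (j + 1 : ℕ) = m.choose j * (m - j : ℕ) := by
    exact_mod_cast Nat.choose_succ_right_eq m j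
  rw [Nat.succ_eq_add_one, Nat.add_sub_cancel, Nat.add_sub_add_right, ← div_eq_mul_inv,
    ← div_eq_mul_inv, div_eq_div_iff hpred hsucc, mul_comm, hrec, mul_comm]

theorem sum_shapleyValue (v : Finset A → ℝ) :
    ∑ i, shapleyValue v i = v Finset.univ - v ∅ := by
  classical
  rcases isEmpty_or_nonempty A with hA | hA
  · simp
  obtain ⟨m, hm⟩ := Nat.exists_eq_succ_of_ne_zero (Fintype.card_ne_zero (α := A))
  have hm0 : (m + 1 : ℝ) ≠ 0 := by positivity
  have hne : (∅ : Finset A) ≠ Finset.univ := Finset.univ_nonempty.ne_empty.symm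
  simp only [shapleyValue]
  rw [← Finset.mul_sum, sum_sum_weight_mul_marginal fun k => ((Fintype.card A - 1).choose k : ℝ)⁻¹,
    ← Finset.sum_subset (Finset.subset_univ {∅, Finset.univ}), Finset.sum_pair hne]
  · simp only [Finset.card_empty, Finset.card_univ, hm, Nat.succ_sub_one, Nat.sub_self,
      Nat.choose_self, Nat.choose_zero_right, Nat.cast_zero, Nat.cast_succ, zero_mul,
      tsub_zero]
    field_simp
    ring
  · intro S _ hS
    simp only [Finset.mem_insert, Finset.mem_singleton, not_or] at hS
    have hlt : S.card < m.succ := hm ▸ (Finset.card_lt_iff_ne_univ S).mpr hS.2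
    rw [hm, Nat.succ_sub_one, mul_inv_choose_pred_eq_mul_inv_choose
      (Finset.card_pos.mpr (Finset.nonempty_iff_ne_empty.mpr hS.1)) (Nat.le_of_lt_succ hlt),
      sub_self, zero_mul]

open Classical in
theorem shapleyValue_mono {v w : Finset A → ℝ} {i : A}
    (h : ∀ S, i ∉ S → w (insert i S) - w S ≤ v (insert i S) - v S) :
    shapleyValue w i ≤ shapleyValue v i := by
  refine mul_le_mul_of_nonneg_left (Finset.sum_le_sum fun S hS => ?_) (by positivity)
  refine mul_le_mul_of_nonneg_left (h S fun hi => ?_) (by positivity)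
  exact Finset.notMem_erase i _ (Finset.mem_powerset.mp hS hi)

open Classical in
theorem shapleyValue_eq_zero {v : Finset A → ℝ} {i : A} (h : ∀ S, v (insert i S) = v S) :
    shapleyValue v i = 0 := by
  simp [shapleyValue, h]

end Shapley

open Classical in
/-- A convex game: the marginal contribution of a player increases with the coalition that it
joins, which for finitely many players is equivalent to supermodularity of `v`. -/
def IsConvexGame (v : Finset A → ℝ) : Prop :=
  ∀ ⦃S D : Finset A⦄ ⦃i : A⦄, S ⊆ D → i ∉ D → v (insert i S) - v S ≤ v (insert i D) - v D

namespace IsConvexGame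

variable {v : Finset A → ℝ}

open Classical in
theorem of_pairwise (hv : ∀ (S : Finset A) (i j : A), i ∉ S → j ∉ S → i ≠ j →
    v (insert i S) + v (insert j S) ≤ v (insert i (insert j S)) + v S) :
    IsConvexGame v := by
  intro S D i hSD hiD
  suffices hunion : ∀ E : Finset A, i ∉ E →
      v (insert i S) - v S ≤ v (insert i (E ∪ S)) - v (E ∪ S) by
    simpa only [Finset.union_eq_left.mpr hSD] using hunion D hiD
  have hiS : i ∉ S := fun h => hiD (hSD h)
  intro E hiE
  induction E using Finset.induction_on with
  | empty => simp
  | insert j E _ ih =>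
    obtain ⟨hij, hiE⟩ : i ≠ j ∧ i ∉ E := by simpa only [Finset.mem_insert, not_or] using hiE
    rw [Finset.insert_union]
    by_cases hj : j ∈ E ∪ S
    · simpa only [Finset.insert_eq_self.mpr hj] using ih hiE
    · linarith [ih hiE, hv (E ∪ S) i j (by simp [hiE, hiS]) hj hij]

theorem shapleyValue_mem_core [Fintype A] (hv : IsConvexGame v) (h0 : v ∅ = 0) :
    shapleyValue v ∈ core v := by
  classical
  refine ⟨by rw [sum_shapleyValue, h0, sub_zero], fun C => ?_⟩
  let w : Finset A → ℝ := fun S => v (S ∩ C)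
  have hout : ∀ i ∉ C, shapleyValue w i = 0 := fun i hi =>
    shapleyValue_eq_zero fun S => congrArg v (Finset.insert_inter_of_notMem hi)
  have hin : ∀ i ∈ C, shapleyValue w i ≤ shapleyValue v i := fun i hi =>
    shapleyValue_mono fun S hS => by
      simpa only [w, Finset.insert_inter_of_mem hi] using hv Finset.inter_subset_left hS
  calc v C = w Finset.univ - w ∅ := by simp [w, h0]
    _ = ∑ i, shapleyValue w i := (sum_shapleyValue w).symm
    _ = ∑ i ∈ C, shapleyValue w i :=
        (Finset.sum_subset (Finset.subset_univ C) fun i _ hi => hout i hi).symm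
    _ ≤ ∑ i ∈ C, shapleyValue v i := Finset.sum_le_sum hin

/-- The errors of the four values in a mixed second difference add up to at most
`(k + 2 (k + 1) + (k + 2)) δ`. -/
theorem of_abs_add_le [Fintype A] {f : ℕ → ℝ} {δ : ℝ} (hv : ∀ C, |v C + f C.card| ≤ C.card * δ)
    (hf : ∀ k, k + 2 ≤ Fintype.card A → f k + f (k + 2) + 4 * (k + 1) * δ ≤ 2 * f (k + 1)) :
    IsConvexGame v := by
  classical
  refine of_pairwise fun S i j hi hj hij => ?_
  have hiS : (insert i S).card = S.card + 1 := Finset.card_insert_of_notMem hi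
  have hjS : (insert j S).card = S.card + 1 := Finset.card_insert_of_notMem hj
  have hijS : (insert i (insert j S)).card = S.card + 2 := by
    rw [Finset.card_insert_of_notMem (by simp [hij, hi]), hjS]
  have hconcave := hf S.card (hijS ▸ Finset.card_le_univ _)
  have hS := abs_le.mp (hv S)
  have hvi := abs_le.mp (hv (insert i S))
  have hvj := abs_le.mp (hv (insert j S))
  have hvij := abs_le.mp (hv (insert i (insert j S)))
  rw [hiS] at hvi
  rw [hjS] at hvj
  rw [hijS] at hvij
  push_cast at hvi hvj hvij
  linarith [hS.1, hvi.2, hvj.2, hvij.1]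

end IsConvexGame

end Games

/-! ### Reading i.i.d. variables in an adaptive order -/

section AdaptiveSampling

section Resampling

variable {ι : Type*} [DecidableEq ι] {E : ι → Type*} [∀ i, MeasurableSpace (E i)]
  (μ : ∀ i, Measure (E i)) [∀ i, IsProbabilityMeasure (μ i)] (p : ι)

theorem measurePreserving_update_infinitePi :
    MeasurePreserving (fun u : (∀ i, E i) × E p => Function.update u.1 p u.2)
      ((Measure.infinitePi μ).prod (μ p)) (Measure.infinitePi μ) := by
  refine ⟨measurable_update', Measure.eq_infinitePi μ fun s t ht => ?_⟩
  rw [Measure.map_apply measurable_update'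
    (MeasurableSet.pi s.countable_toSet fun i _ => ht i)]
  have hpreimage : (fun u : (∀ i, E i) × E p => Function.update u.1 p u.2) ⁻¹' (s : Set ι).pi t =
      ((s.erase p : Finset ι) : Set ι).pi t ×ˢ {z | p ∈ s → z ∈ t p} := by
    ext u
    rw [Set.mem_preimage, Set.update_mem_pi_iff, Finset.coe_erase]
    rfl
  rw [hpreimage, Measure.prod_prod, Measure.infinitePi_pi μ fun i _ => ht i]
  by_cases hp : p ∈ s
  · simpa [hp] using Finset.prod_erase_mul s (fun i => μ i (t i)) hp
  · simp [hp]

theorem infinitePi_inter_coordinate {B : Set (∀ i, E i)} (hB : MeasurableSet B)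
    (hinv : ∀ η ∈ B, ∀ z, Function.update η p z ∈ B) {D : Set (E p)} (hD : MeasurableSet D) :
    Measure.infinitePi μ (B ∩ (fun η => η p) ⁻¹' D) = Measure.infinitePi μ B * μ p D := by
  have hupdate (η : ∀ i, E i) (z : E p) : Function.update η p z ∈ B ↔ η ∈ B :=
    ⟨fun h => by simpa using hinv _ h (η p), fun h => hinv η h z⟩
  rw [← (measurePreserving_update_infinitePi μ p).measure_preimage
    (hB.inter (measurable_pi_apply p hD)).nullMeasurableSet, ← Measure.prod_prod]
  congr 1
  ext u
  simp [hupdate]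

end Resampling

variable {ι E : Type*} [MeasurableSpace E]

/-- A rule that reads the coordinates of a point of `ι → E` one after the other: `Q η s` is the
coordinate read at step `s`. It is chosen on the basis of the values read before, and no coordinate
is read twice. -/
structure IsSamplingRule (Q : (ι → E) → ℕ → ι) : Prop where
  measurableSet_fiber : ∀ s q, MeasurableSet ((fun η => Q η s) ⁻¹' {q})
  injective : ∀ η, Function.Injective (Q η)
  causal : ∀ η η' s, (∀ r < s, η (Q η r) = η' (Q η' r)) → Q η s = Q η' s

theorem IsSamplingRule.update_eq [DecidableEq ι] {Q : (ι → E) → ℕ → ι} (hQ : IsSamplingRule Q)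
    (η : ι → E) (z : E) {n s : ℕ} (hs : s ≤ n) :
    Q (Function.update η (Q η n) z) s = Q η s := by
  induction s using Nat.strong_induction_on with
  | _ s ih =>
    refine hQ.causal _ _ s fun r hr => ?_
    rw [ih r hr (hr.le.trans hs), Function.update_of_ne fun h =>
      (hr.trans_le hs).ne (hQ.injective η h)]

variable [Countable ι]

theorem measurable_random_coordinate {Ω : Type*} [MeasurableSpace Ω] {g : Ω → ι → E}
    (hg : Measurable g) {p : Ω → ι} (hp : ∀ q, MeasurableSet (p ⁻¹' {q})) :
    Measurable fun u => g u (p u) := by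
  let : MeasurableSpace ι := ⊤
  have heval : Measurable fun u : ι × (ι → E) => u.2 u.1 :=
    measurable_from_prod_countable_right measurable_pi_apply
  exact heval.comp ((measurable_to_countable' hp).prodMk hg)

variable (μ : Measure E) [IsProbabilityMeasure μ]

theorem infinitePi_inter_random_coordinate [DecidableEq ι] {p : (ι → E) → ι}
    (hp : ∀ q, MeasurableSet (p ⁻¹' {q})) (hpinv : ∀ η z, p (Function.update η (p η) z) = p η)
    {B : Set (ι → E)} (hB : MeasurableSet B) (hBinv : ∀ η ∈ B, ∀ z, Function.update η (p η) z ∈ B)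
    {D : Set E} (hD : MeasurableSet D) :
    Measure.infinitePi (fun _ : ι => μ) (B ∩ (fun η => η (p η)) ⁻¹' D) =
      Measure.infinitePi (fun _ : ι => μ) B * μ D := by
  have hfiber (q : ι) : MeasurableSet (B ∩ p ⁻¹' {q}) := hB.inter (hp q)
  have hdisjoint : Pairwise (Function.onFun Disjoint fun q => B ∩ p ⁻¹' {q}) := fun q q' hq =>
    Set.disjoint_left.mpr fun η h h' => hq (h.2.symm.trans h'.2)
  have hunion : B = ⋃ q, B ∩ p ⁻¹' {q} := by ext η; simp
  have hunion_inter : B ∩ (fun η => η (p η)) ⁻¹' D =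
      ⋃ q, B ∩ p ⁻¹' {q} ∩ (fun η => η q) ⁻¹' D := by
    ext η
    simp only [Set.mem_inter_iff, Set.mem_iUnion, Set.mem_preimage, Set.mem_singleton_iff]
    exact ⟨fun h => ⟨p η, ⟨h.1, rfl⟩, h.2⟩, fun ⟨_, ⟨hη, rfl⟩, h⟩ => ⟨hη, h⟩⟩
  rw [hunion_inter, measure_iUnion
      (fun q q' h => (hdisjoint h).mono Set.inter_subset_left Set.inter_subset_left)
      fun q => (hfiber q).inter (measurable_pi_apply q hD),
    tsum_congr fun q => infinitePi_inter_coordinate (fun _ => μ) q (hfiber q) ?_ hD,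
    ENNReal.tsum_mul_right, ← measure_iUnion hdisjoint hfiber, ← hunion]
  rintro η ⟨hη, rfl⟩ z
  exact ⟨hBinv η hη z, hpinv η z⟩

namespace IsSamplingRule

variable {Q : (ι → E) → ℕ → ι} (hQ : IsSamplingRule Q)
include hQ

theorem measurable_sample (s : ℕ) : Measurable fun η : ι → E => η (Q η s) :=
  measurable_random_coordinate measurable_id (hQ.measurableSet_fiber s)

theorem infinitePi_box {t : ℕ → Set E} (ht : ∀ r, MeasurableSet (t r)) (n : ℕ) :
    Measure.infinitePi (fun _ : ι => μ) {η : ι → E | ∀ r < n, η (Q η r) ∈ t r} =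
      ∏ r ∈ Finset.range n, μ (t r) := by
  classical
  induction n with
  | zero => simp
  | succ n ih =>
    have hbox : MeasurableSet {η : ι → E | ∀ r < n, η (Q η r) ∈ t r} := by
      simp only [Set.ofPred_forall]
      exact MeasurableSet.iInter fun r => MeasurableSet.iInter fun _ =>
        hQ.measurable_sample r (ht r)
    have hsucc : {η : ι → E | ∀ r < n + 1, η (Q η r) ∈ t r} =
        {η : ι → E | ∀ r < n, η (Q η r) ∈ t r} ∩ (fun η => η (Q η n)) ⁻¹' t n := by
      ext η
      exact Nat.forall_lt_succ_right
    rw [hsucc, Finset.prod_range_succ, ← ih, infinitePi_inter_random_coordinate μ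
      (hQ.measurableSet_fiber n) (fun η z => hQ.update_eq η z le_rfl) hbox
      (fun η hη z r hr => ?_) (ht n)]
    rw [hQ.update_eq η z hr.le, Function.update_of_ne fun h => hr.ne (hQ.injective η h)]
    exact hη r hr

theorem measurePreserving_sample :
    MeasurePreserving (fun (η : ι → E) s => η (Q η s)) (Measure.infinitePi fun _ : ι => μ)
      (Measure.infinitePi fun _ : ℕ => μ) := by
  classical
  have hmeas : Measurable fun (η : ι → E) s => η (Q η s) :=
    measurable_pi_lambda _ hQ.measurable_sample
  refine ⟨hmeas, Measure.eq_infinitePi _ fun s t ht => ?_⟩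
  rw [Measure.map_apply hmeas (MeasurableSet.pi s.countable_toSet fun i _ => ht i)]
  obtain ⟨n, hn⟩ := s.exists_nat_subset_range
  have hbox := hQ.infinitePi_box μ (t := fun i => if i ∈ s then t i else Set.univ)
    (fun i => by split_ifs; exacts [ht i, MeasurableSet.univ]) n
  rw [← Finset.prod_subset hn fun i _ hi => by simp [hi]] at hbox
  convert hbox using 1
  · congr 1
    ext η
    simp only [Set.mem_preimage, Set.mem_pi, Finset.mem_coe, Set.mem_ofPred_eq,
      Set.mem_ite_univ_right]
    exact ⟨fun h r _ hr => h r hr, fun h r hr => h r (Finset.mem_range.mp (hn hr)) hr⟩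
  · exact Finset.prod_congr rfl fun i hi => by simp [hi]

end IsSamplingRule

end AdaptiveSampling

/-! ### The buffers of the meta-algorithm -/

section Buffers

variable {d : ℕ} {A : Type*} {X : Finset (EuclideanSpace ℝ (Fin d))} {C : Finset A}

/-- The buffers of the meta-algorithm with the values of the rewards forgotten: a reward is
identified by the agent `a ∈ unread x` that observed it and by the time `fillTime x` at which the
buffer of `x` was last filled. The counters `plays` and `reads` record the number of time-steps
played and of rewards read so far. -/
structure BufferState (X : Finset (EuclideanSpace ℝ (Fin d))) (C : Finset A) where
  unread : X → Finset C
  fillTime : X → ℕ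
  plays : ℕ
  reads : ℕ

namespace BufferState

open Classical in
/-- The buffers after a time-step at which all agents play `x`. -/
def fill (σ : BufferState X C) (x : X) : BufferState X C :=
  { σ with
    unread := Function.update σ.unread x Finset.univ
    fillTime := Function.update σ.fillTime x σ.plays
    plays := σ.plays + 1 }

/-- The buffers at the moment when the reward of a simulated play of `x` is read: if the buffer
of `x` was empty, then `x` has been played once more. -/
def prepare (σ : BufferState X C) (x : X) : BufferState X C :=
  if (σ.unread x).Nonempty then σ else σ.fill x

theorem prepare_of_nonempty {σ : BufferState X C} {x : X} (h : (σ.unread x).Nonempty) :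
    σ.prepare x = σ := if_pos h

theorem prepare_of_eq_empty {σ : BufferState X C} {x : X} (h : σ.unread x = ∅) :
    σ.prepare x = σ.fill x := if_neg (by simp [h])

theorem plays_le_plays_prepare (σ : BufferState X C) (x : X) : σ.plays ≤ (σ.prepare x).plays := by
  unfold prepare
  split_ifs
  exacts [le_rfl, Nat.le_succ _]

/-- Distinct buffers were filled at distinct past times, and none of their rewards is in `U`, the
set of the rewards that have been read. -/
structure Fresh (σ : BufferState X C) (U : Set (A × ℕ)) : Prop where
  fillTime_lt : ∀ y, (σ.unread y).Nonempty → σ.fillTime y < σ.plays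
  fillTime_ne : ∀ y y', y ≠ y' → (σ.unread y).Nonempty → (σ.unread y').Nonempty →
    σ.fillTime y ≠ σ.fillTime y'
  used_lt : ∀ u ∈ U, u.2 < σ.plays
  unread_notMem : ∀ y, ∀ a ∈ σ.unread y, ((a : A), σ.fillTime y) ∉ U

theorem Fresh.prepare {σ : BufferState X C} {U : Set (A × ℕ)} (h : σ.Fresh U) (x : X) :
    (σ.prepare x).Fresh U := by
  by_cases hx : (σ.unread x).Nonempty
  · rwa [prepare_of_nonempty hx]
  rw [prepare_of_eq_empty (Finset.not_nonempty_iff_eq_empty.mp hx)]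
  refine ⟨fun y hy => ?_, fun y y' hne hy hy' => ?_, fun u hu => (h.used_lt u hu).trans_le
    (Nat.le_succ _), fun y a ha hu => ?_⟩
  · rcases eq_or_ne y x with rfl | hyx
    · simp [fill]
    · simp only [fill, Function.update_of_ne hyx] at hy ⊢
      exact (h.fillTime_lt y hy).trans (Nat.lt_succ_self _)
  · rcases eq_or_ne y x with rfl | hyx
    · simp only [fill, Function.update_self, Function.update_of_ne hne.symm] at hy' ⊢
      exact (h.fillTime_lt y' hy').ne'
    rcases eq_or_ne y' x with rfl | hyx'
    · simp only [fill, Function.update_self, Function.update_of_ne hne] at hy ⊢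
      exact (h.fillTime_lt y hy).ne
    · simp only [fill, Function.update_of_ne hyx, Function.update_of_ne hyx'] at hy hy' ⊢
      exact h.fillTime_ne y y' hne hy hy'
  · rcases eq_or_ne y x with rfl | hyx
    · simpa [fill] using h.used_lt _ hu
    · simp only [fill, Function.update_of_ne hyx] at ha hu
      exact h.unread_notMem y a ha hu

variable [Nonempty C]

theorem prepare_unread_nonempty (σ : BufferState X C) (x : X) :
    ((σ.prepare x).unread x).Nonempty := by
  by_cases h : (σ.unread x).Nonempty
  · rwa [prepare_of_nonempty h]
  · rw [prepare_of_eq_empty (Finset.not_nonempty_iff_eq_empty.mp h)]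
    simp only [fill, Function.update_self, Finset.univ_nonempty]

variable (ρ : RemovalRule A X)

/-- The agent whose reward is read when `x` is played in the simulation. -/
def reader (σ : BufferState X C) (x : X) : C :=
  (ρ C σ.reads x ((σ.prepare x).unread x) (σ.prepare_unread_nonempty x)).1

theorem reader_mem (σ : BufferState X C) (x : X) : σ.reader ρ x ∈ (σ.prepare x).unread x :=
  (ρ C σ.reads x ((σ.prepare x).unread x) (σ.prepare_unread_nonempty x)).2

/-- The agent and the time from which the reward of a simulated play of `x` originates. -/
def source (σ : BufferState X C) (x : X) : A × ℕ := (σ.reader ρ x, (σ.prepare x).fillTime x)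

open Classical in
/-- The buffers after a simulated play of `x`. -/
def read (σ : BufferState X C) (x : X) : BufferState X C :=
  { σ.prepare x with
    unread := Function.update (σ.prepare x).unread x
      (((σ.prepare x).unread x).erase (σ.reader ρ x))
    reads := σ.reads + 1 }

theorem unread_read_subset (σ : BufferState X C) (x y : X) :
    (σ.read ρ x).unread y ⊆ (σ.prepare x).unread y := by
  classical
  rcases eq_or_ne y x with rfl | hyx
  · simpa only [read, Function.update_self] using Finset.erase_subset _ _
  · simp only [read, Function.update_of_ne hyx, Finset.Subset.refl]

theorem Fresh.source_notMem {σ : BufferState X C} {U : Set (A × ℕ)} (h : σ.Fresh U) (x : X) :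
    σ.source ρ x ∉ U :=
  (h.prepare x).unread_notMem x _ (σ.reader_mem ρ x)

theorem Fresh.read {σ : BufferState X C} {U : Set (A × ℕ)} (h : σ.Fresh U) (x : X) :
    (σ.read ρ x).Fresh (insert (σ.source ρ x) U) := by
  have hprepare := h.prepare x
  have hsub := σ.unread_read_subset ρ x
  refine ⟨fun y hy => hprepare.fillTime_lt y (hy.mono (hsub y)), fun y y' hne hy hy' =>
    hprepare.fillTime_ne y y' hne (hy.mono (hsub y)) (hy'.mono (hsub y')), ?_, ?_⟩
  · rintro u (rfl | hu)
    · exact hprepare.fillTime_lt x (σ.prepare_unread_nonempty x)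
    · exact hprepare.used_lt u hu
  · rintro y a ha (hu | hu)
    · obtain ⟨hagent, htime⟩ := Prod.ext_iff.mp hu
      rcases eq_or_ne y x with rfl | hyx
      · simp only [BufferState.read, Function.update_self, Finset.mem_erase] at ha
        exact ha.1 (Subtype.ext hagent)
      · exact hprepare.fillTime_ne y x hyx ⟨a, hsub y ha⟩ (σ.prepare_unread_nonempty x) htime
    · exact hprepare.unread_notMem y a (hsub y ha) hu

end BufferState

variable [Nonempty C] (ρ : RemovalRule A X)

variable (C) in
/-- The buffers after the simulated play of the actions in the list `l`. -/
def bufferState (l : List X) : BufferState X C :=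
  l.foldl (BufferState.read ρ) ⟨fun _ => ∅, fun _ => 0, 0, 0⟩

theorem bufferState_concat (l : List X) (x : X) :
    bufferState C ρ (l ++ [x]) = (bufferState C ρ l).read ρ x := by
  simp only [bufferState, List.foldl_append, List.foldl_cons, List.foldl_nil]

theorem reads_bufferState (l : List X) : (bufferState C ρ l).reads = l.length := by
  induction l using List.reverseRecOn with
  | nil => rfl
  | append_singleton l x ih =>
    rw [bufferState_concat, List.length_append, ← ih]
    rfl

theorem fresh_bufferState (l : List X) :
    (bufferState C ρ l).Fresh
      {u | ∃ l' x, l' ++ [x] <+: l ∧ (bufferState C ρ l').source ρ x = u} := by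
  induction l using List.reverseRecOn with
  | nil => constructor <;> simp [bufferState]
  | append_singleton l x ih =>
    rw [bufferState_concat]
    convert ih.read ρ x using 1
    ext u
    simp only [List.prefix_concat_iff, Set.mem_insert_iff, Set.mem_ofPred_eq]
    constructor
    · rintro ⟨l', x', h | h, rfl⟩
      · obtain ⟨rfl, ⟨⟩⟩ := List.append_inj' h rfl
        exact Or.inl rfl
      · exact Or.inr ⟨l', x', h, rfl⟩
    · rintro (rfl | ⟨l', x', h, rfl⟩)
      · exact ⟨l, x, Or.inl rfl, rfl⟩
      · exact ⟨l', x', Or.inr h, rfl⟩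

theorem source_bufferState_ne {l l' : List X} {x' : X} (h : l' ++ [x'] <+: l) (x : X) :
    (bufferState C ρ l').source ρ x' ≠ (bufferState C ρ l).source ρ x := fun hsource =>
  (fresh_bufferState ρ l).source_notMem ρ x ⟨l', x', h, hsource⟩

theorem plays_bufferState_mono {l l' : List X} (h : l' <+: l) :
    (bufferState C ρ l').plays ≤ (bufferState C ρ l).plays := by
  obtain ⟨m, rfl⟩ := h
  induction m using List.reverseRecOn with
  | nil => rw [List.append_nil]
  | append_singleton m x ih =>
    rw [← List.append_assoc, bufferState_concat]
    exact ih.trans (BufferState.plays_le_plays_prepare _ x)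

theorem plays_bufferState_lt {l l' : List X} {x : X} (h : l' ++ [x] <+: l)
    (hempty : (bufferState C ρ l').unread x = ∅) :
    (bufferState C ρ l').plays < (bufferState C ρ l).plays := by
  have hle := plays_bufferState_mono (C := C) ρ h
  rw [bufferState_concat] at hle
  refine lt_of_lt_of_le ?_ hle
  simp only [BufferState.read, BufferState.prepare_of_eq_empty hempty, BufferState.fill,
    Nat.lt_succ_self]

end Buffers

/-! ### The simulated play -/

section SinglePlay

variable {d : ℕ} (I : FixedInstance d) (Sin : SingleAgentAlgorithm I.X)

/-- The action at step `s` of a run of `Sin` with seed `ω` and noise terms `ξ`. -/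
def singleAction (ω : Sin.Seed) (ξ : ℕ → ℝ) (s : ℕ) : I.X :=
  Sin.act ω (singleHistory I Sin ω ξ s)

theorem singleHistory_congr (ω : Sin.Seed) {ξ ξ' : ℕ → ℝ} {s : ℕ} (h : ∀ r < s, ξ r = ξ' r) :
    singleHistory I Sin ω ξ s = singleHistory I Sin ω ξ' s := by
  induction s with
  | zero => rfl
  | succ s ih =>
    simp only [singleHistory, ih fun r hr => h r (hr.trans_le s.le_succ), h s s.lt_succ_self]

theorem singleHistory_eq_ofFn (ω : Sin.Seed) (ξ : ℕ → ℝ) (s : ℕ) :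
    singleHistory I Sin ω ξ s = List.ofFn fun i : Fin s =>
      (singleAction I Sin ω ξ i, I.meanReward (singleAction I Sin ω ξ i) + ξ i) := by
  induction s with
  | zero => rfl
  | succ s ih =>
    rw [List.ofFn_succ', List.concat_eq_append]
    simp only [Fin.val_castSucc, Fin.val_last]
    rw [← ih]
    rfl

variable {I Sin} {Ω : Type*} [MeasurableSpace Ω] {ω : Ω → Sin.Seed} {ξ : Ω → ℕ → ℝ} {s : ℕ}

theorem measurable_singleAction (hω : Measurable ω) (hξ : ∀ r < s, Measurable fun u => ξ u r) :
    Measurable fun u => singleAction I Sin (ω u) (ξ u) s := by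
  induction s using Nat.strong_induction_on with
  | _ s ih =>
    change Measurable fun u => Sin.act (ω u) (singleHistory I Sin (ω u) (ξ u) s)
    simp only [singleHistory_eq_ofFn]
    refine (Sin.measurable_act s).comp (hω.prodMk (measurable_pi_lambda _ fun i => ?_))
    have haction := ih i i.2 fun r hr => hξ r (hr.trans i.2)
    exact haction.prodMk
      (((measurable_of_countable fun x : I.X => I.meanReward x).comp haction).add (hξ i i.2))

theorem measurableSet_singleActions (hω : Measurable ω) (hξ : ∀ r < s, Measurable fun u => ξ u r)
    (P : List I.X → I.X → Prop) :
    MeasurableSet {u | P ((singleHistory I Sin (ω u) (ξ u) s).map Prod.fst)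
      (singleAction I Sin (ω u) (ξ u) s)} := by
  have hpast : Measurable fun u => fun i : Fin s => singleAction I Sin (ω u) (ξ u) i :=
    measurable_pi_lambda _ fun i =>
      measurable_singleAction hω fun r hr => hξ r (hr.trans i.2)
  have hset : MeasurableSet {z : (Fin s → I.X) × I.X | P (List.ofFn z.1) z.2} :=
    (Set.to_countable _).measurableSet
  convert (hpast.prodMk (measurable_singleAction hω hξ)) hset using 1
  ext u
  simp only [singleHistory_eq_ofFn, List.map_ofFn]
  rfl

end SinglePlay

section SimulatedPlay

variable {d : ℕ} {A : Type*} (I : FixedInstance d) (Sin : SingleAgentAlgorithm I.X)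
  (ρ : RemovalRule A I.X) (C : Finset A) [Nonempty C]

/-- The history of the first `s` steps of the play of `Sin` that the meta-algorithm simulates for
the coalition `C`, where `p` consists of the seed and the noise terms of the agents. It is defined
without reference to the states of the meta-algorithm: `bufferState` tells which noise term enters
each step. -/
def simHistory (p : Sin.Seed × (A × ℕ → ℝ)) : ℕ → List (I.X × ℝ)
  | 0 => []
  | s + 1 =>
    let h := simHistory p s
    let x := Sin.act p.1 h
    h ++ [(x, I.meanReward x + p.2 ((bufferState C ρ (h.map Prod.fst)).source ρ x))]

variable (p : Sin.Seed × (A × ℕ → ℝ))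

/-- The action at step `s` of the simulated play. -/
def simAction (s : ℕ) : I.X := Sin.act p.1 (simHistory I Sin ρ C p s)

/-- The buffers after `s` steps of the simulated play. -/
def simBuffers (s : ℕ) : BufferState I.X C :=
  bufferState C ρ ((simHistory I Sin ρ C p s).map Prod.fst)

/-- The agent and the time whose noise term enters step `s` of the simulated play. -/
def simSource (s : ℕ) : A × ℕ := (simBuffers I Sin ρ C p s).source ρ (simAction I Sin ρ C p s)

/-- The noise terms of the simulated play. -/
def simNoise (s : ℕ) : ℝ := p.2 (simSource I Sin ρ C p s)

theorem simHistory_succ (s : ℕ) :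
    simHistory I Sin ρ C p (s + 1) = simHistory I Sin ρ C p s ++
      [(simAction I Sin ρ C p s,
        I.meanReward (simAction I Sin ρ C p s) + simNoise I Sin ρ C p s)] := rfl

theorem simBuffers_succ (s : ℕ) :
    simBuffers I Sin ρ C p (s + 1) =
      (simBuffers I Sin ρ C p s).read ρ (simAction I Sin ρ C p s) := by
  rw [simBuffers, simHistory_succ, List.map_append]
  exact bufferState_concat ρ _ _

theorem simHistory_eq_singleHistory (s : ℕ) :
    simHistory I Sin ρ C p s = singleHistory I Sin p.1 (simNoise I Sin ρ C p) s := by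
  induction s with
  | zero => rfl
  | succ s ih => rw [simHistory_succ, singleHistory, simAction, ih]

theorem simAction_eq_singleAction (s : ℕ) :
    simAction I Sin ρ C p s = singleAction I Sin p.1 (simNoise I Sin ρ C p) s := by
  rw [simAction, simHistory_eq_singleHistory, singleAction]

theorem simActions_concat_prefix {r s : ℕ} (h : r < s) :
    (simHistory I Sin ρ C p r).map Prod.fst ++ [simAction I Sin ρ C p r] <+:
      (simHistory I Sin ρ C p s).map Prod.fst := by
  induction s with
  | zero => exact absurd h r.not_lt_zero
  | succ s ih =>
    rw [simHistory_succ, List.map_append, List.map_singleton, List.prefix_concat_iff]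
    rcases Nat.lt_succ_iff_lt_or_eq.mp h with hlt | rfl
    exacts [Or.inr (ih hlt), Or.inl rfl]

theorem simBuffers_step_unique {s s' : ℕ}
    (hplays : (simBuffers I Sin ρ C p s).plays = (simBuffers I Sin ρ C p s').plays)
    (hs : (simBuffers I Sin ρ C p s).unread (simAction I Sin ρ C p s) = ∅)
    (hs' : (simBuffers I Sin ρ C p s').unread (simAction I Sin ρ C p s') = ∅) : s = s' := by
  rcases lt_trichotomy s s' with h | h | h
  · exact absurd hplays (plays_bufferState_lt ρ (simActions_concat_prefix I Sin ρ C p h) hs).ne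
  · exact h
  · exact absurd hplays (plays_bufferState_lt ρ (simActions_concat_prefix I Sin ρ C p h) hs').ne'

section Law

variable [Countable A]

theorem measurable_simNoise (s : ℕ) : Measurable fun p => simNoise I Sin ρ C p s := by
  induction s using Nat.strong_induction_on with
  | _ s ih =>
    refine measurable_random_coordinate measurable_snd fun q => ?_
    simp only [simSource, simBuffers, simAction_eq_singleAction, simHistory_eq_singleHistory]
    exact measurableSet_singleActions measurable_fst ih
      fun l x => (bufferState C ρ l).source ρ x = q

theorem measurableSet_simActions (s : ℕ) (P : List I.X → I.X → Prop) :
    MeasurableSet {p | P ((simHistory I Sin ρ C p s).map Prod.fst) (simAction I Sin ρ C p s)} := by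
  simp only [simAction_eq_singleAction, simHistory_eq_singleHistory]
  exact measurableSet_singleActions measurable_fst
    (fun r _ => measurable_simNoise I Sin ρ C r) P

theorem isSamplingRule_simSource (ω : Sin.Seed) :
    IsSamplingRule fun η s => simSource I Sin ρ C (ω, η) s where
  measurableSet_fiber s q := measurable_prodMk_left
    (measurableSet_simActions I Sin ρ C s fun l x => (bufferState C ρ l).source ρ x = q)
  injective η := Function.injective_iff_pairwise_ne.mpr <| pairwise_iff_lt.mpr fun _ _ h =>
    source_bufferState_ne ρ (simActions_concat_prefix I Sin ρ C (ω, η) h) _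
  causal η η' s h := by
    have hnoise : ∀ r < s, simNoise I Sin ρ C (ω, η) r = simNoise I Sin ρ C (ω, η') r := h
    simp only [simSource, simBuffers, simAction, simHistory_eq_singleHistory]
    rw [singleHistory_congr I Sin ω hnoise]

theorem measurePreserving_simNoise :
    MeasurePreserving (fun p => (p.1, simNoise I Sin ρ C p))
      (Sin.seedLaw.prod (Measure.infinitePi fun _ : A × ℕ => I.noise))
      (Sin.seedLaw.prod (Measure.infinitePi fun _ : ℕ => I.noise)) :=
  (MeasurePreserving.id _).skew_product (g := fun ω η => simNoise I Sin ρ C (ω, η))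
    (measurable_pi_lambda _ (measurable_simNoise I Sin ρ C))
    (.of_forall fun ω =>
      ((isSamplingRule_simSource I Sin ρ C ω).measurePreserving_sample I.noise).map_eq)

end Law

end SimulatedPlay

/-! ### The meta-algorithm follows the simulated play -/

section MulFollows

variable {d : ℕ} {A : Type*} (I : FixedInstance d) (Sin : SingleAgentAlgorithm I.X)
  (ρ : RemovalRule A I.X) (C : Finset A) (p : Sin.Seed × (A × ℕ → ℝ))

/-- The state of the meta-algorithm for the coalition `C` after `t` time-steps, where `p` consists
of the seed and the noise terms of the agents. -/
def mulStateAt (t : ℕ) : MulState I.X C :=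
  mulState Sin ρ C p.1 (coalitionHistory I (mulAlgorithm Sin ρ) C p.1 p.2 t)

theorem mulStateAt_succ (t : ℕ) :
    mulStateAt I Sin ρ C p (t + 1) = mulDrain Sin ρ p.1 (mulReplenish (mulStateAt I Sin ρ C p t)
      fun a => I.meanReward (mulStateAt I Sin ρ C p t).cur + p.2 (a, t)) := by
  change mulState Sin ρ C p.1 (coalitionHistory I (mulAlgorithm Sin ρ) C p.1 p.2 t ++ [_]) = _
  rw [mulState, List.foldl_append]
  rfl

theorem mulStateAt_avail_cur (t : ℕ) :
    (mulStateAt I Sin ρ C p t).avail (mulStateAt I Sin ρ C p t).cur = ∅ := by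
  cases t with
  | zero => rfl
  | succ t => rw [mulStateAt_succ, mulDrain_avail_cur]

section Follows

variable {I Sin} {ρ C p} [Nonempty C] {st : MulState I.X C} {s t : ℕ}

variable (ρ p) in
/-- The state `st` of the meta-algorithm has simulated `s` steps, and `σ` describes the rewards in
its buffers. -/
structure Follows (st : MulState I.X C) (s : ℕ) (σ : BufferState I.X C) : Prop where
  hist : st.hist = simHistory I Sin ρ C p s
  cur : st.cur = simAction I Sin ρ C p s
  avail : st.avail = σ.unread
  reward : ∀ y, ∀ a ∈ σ.unread y, st.reward y a = I.meanReward y + p.2 (a, σ.fillTime y)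

open Classical in
theorem Follows.read
    (h : Follows ρ p st s ((simBuffers I Sin ρ C p s).prepare (simAction I Sin ρ C p s))) :
    Follows ρ p (mulRead Sin ρ p.1 st) (s + 1) (simBuffers I Sin ρ C p (s + 1)) := by
  obtain ⟨avail, reward, hist, cur⟩ := st
  obtain ⟨rfl, rfl, rfl, hreward⟩ := h
  set σ := simBuffers I Sin ρ C p s
  set x := simAction I Sin ρ C p s
  simp only at hreward
  have hlength : (simHistory I Sin ρ C p s).length = σ.reads :=
    ((reads_bufferState ρ _).trans (List.length_map _)).symm
  have hhist : simHistory I Sin ρ C p s ++ [(x, reward x (σ.reader ρ x))] =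
      simHistory I Sin ρ C p (s + 1) := by
    rw [simHistory_succ, hreward x _ (σ.reader_mem ρ x)]
    rfl
  have hread : mulRead Sin ρ p.1 ⟨(σ.prepare x).unread, reward, simHistory I Sin ρ C p s, x⟩ =
      ⟨(σ.read ρ x).unread, reward, simHistory I Sin ρ C p (s + 1),
        simAction I Sin ρ C p (s + 1)⟩ := by
    simp only [mulRead, σ.prepare_unread_nonempty x, dif_pos, hlength]
    rw [simAction, ← hhist]
    rfl
  rw [hread, simBuffers_succ]
  exact ⟨rfl, rfl, rfl, fun y a ha => hreward y a (σ.unread_read_subset ρ x y ha)⟩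

theorem Follows.read_of_nonempty (h : Follows ρ p st s (simBuffers I Sin ρ C p s))
    (hne : (st.avail st.cur).Nonempty) :
    Follows ρ p (mulRead Sin ρ p.1 st) (s + 1) (simBuffers I Sin ρ C p (s + 1)) ∧
      (simBuffers I Sin ρ C p (s + 1)).plays = (simBuffers I Sin ρ C p s).plays := by
  rw [h.avail, h.cur] at hne
  have hprepare := BufferState.prepare_of_nonempty hne
  refine ⟨Follows.read (hprepare.symm ▸ h), ?_⟩
  rw [simBuffers_succ, BufferState.read, hprepare]

theorem Follows.iterate_read (h : Follows ρ p st s (simBuffers I Sin ρ C p s)) (k : ℕ) :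
    ∃ s', Follows ρ p ((mulRead Sin ρ p.1)^[k] st) s' (simBuffers I Sin ρ C p s') ∧
      (simBuffers I Sin ρ C p s').plays = (simBuffers I Sin ρ C p s).plays := by
  induction k generalizing st s with
  | zero => exact ⟨s, h, rfl⟩
  | succ k ih =>
    rw [Function.iterate_succ_apply]
    by_cases hne : (st.avail st.cur).Nonempty
    · obtain ⟨hnext, hplays⟩ := h.read_of_nonempty hne
      obtain ⟨s', hlast, hplays'⟩ := ih hnext
      exact ⟨s', hlast, hplays'.trans hplays⟩
    · rw [show mulRead Sin ρ p.1 st = st from dif_neg hne]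
      exact ih h

theorem Follows.replenish (h : Follows ρ p st s (simBuffers I Sin ρ C p s))
    (hempty : st.avail st.cur = ∅) :
    Follows ρ p (mulReplenish st fun a =>
        I.meanReward st.cur + p.2 (a, (simBuffers I Sin ρ C p s).plays)) s
      ((simBuffers I Sin ρ C p s).prepare (simAction I Sin ρ C p s)) := by
  rw [h.avail, h.cur] at hempty
  rw [BufferState.prepare_of_eq_empty hempty]
  refine ⟨h.hist, h.cur, ?_, fun y a ha => ?_⟩
  · simp only [mulReplenish, BufferState.fill, h.avail, h.cur]
  simp only [mulReplenish, BufferState.fill, h.cur] at ha ⊢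
  rcases eq_or_ne y (simAction I Sin ρ C p s) with rfl | hy
  · simp only [Function.update_self]
  · simp only [Function.update_of_ne hy] at ha ⊢
    exact h.reward y a ha

variable (I Sin ρ C p)

theorem exists_follows_mulStateAt (t : ℕ) :
    ∃ s, Follows ρ p (mulStateAt I Sin ρ C p t) s (simBuffers I Sin ρ C p s) ∧
      (simBuffers I Sin ρ C p s).plays = t := by
  induction t with
  | zero => exact ⟨0, ⟨rfl, rfl, rfl, fun _ _ ha => absurd ha (Finset.notMem_empty _)⟩, rfl⟩
  | succ t ih =>
    obtain ⟨s, hfollows, rfl⟩ := ih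
    set t := (simBuffers I Sin ρ C p s).plays
    have hempty := mulStateAt_avail_cur I Sin ρ C p t
    have hfilled := hfollows.replenish hempty
    have hne := BufferState.prepare_unread_nonempty (simBuffers I Sin ρ C p s)
      (simAction I Sin ρ C p s)
    rw [← hfilled.avail, ← hfilled.cur] at hne
    rw [mulStateAt_succ, mulDrain, ← mulRead_of_nonempty Sin ρ p.1 _ hne,
      Function.iterate_succ_apply]
    obtain ⟨s', hfollows', hplays⟩ := hfilled.read.iterate_read _
    refine ⟨s', hfollows', hplays.trans ?_⟩
    rw [hfollows.avail, hfollows.cur] at hempty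
    rw [simBuffers_succ, BufferState.read, BufferState.prepare_of_eq_empty hempty]
    rfl

theorem mulStateAt_cur_eq_iff (t : ℕ) (y : I.X) :
    (mulStateAt I Sin ρ C p t).cur = y ↔ ∃ s, (simBuffers I Sin ρ C p s).plays = t ∧
      (simBuffers I Sin ρ C p s).unread (simAction I Sin ρ C p s) = ∅ ∧
        simAction I Sin ρ C p s = y := by
  obtain ⟨s, hfollows, hplays⟩ := exists_follows_mulStateAt I Sin ρ C p t
  have hempty := mulStateAt_avail_cur I Sin ρ C p t
  rw [hfollows.avail, hfollows.cur] at hempty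
  rw [hfollows.cur]
  refine ⟨fun hy => ⟨s, hplays, hempty, hy⟩, ?_⟩
  rintro ⟨s', hplays', hempty', hy⟩
  rwa [simBuffers_step_unique I Sin ρ C p (hplays.trans hplays'.symm) hempty hempty']

end Follows

end MulFollows

section Conservation

variable {d : ℕ} {A : Type*}

section MulTotal

variable {X : Finset (EuclideanSpace ℝ (Fin d))} {C : Finset A} (f : X → ℝ)

/-- The sum of `f x` over all rewards received so far, where `x` is the action that earned the
reward; a reward has either been read into the simulated history or is still in a buffer. -/
def mulTotal (st : MulState X C) : ℝ :=
  (st.hist.map fun u => f u.1).sum + ∑ y, ((st.avail y).card : ℝ) * f y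

theorem sum_card_update_mul [DecidableEq X] (avail : X → Finset C) (x : X) (B : Finset C) :
    ∑ y, ((Function.update avail x B y).card : ℝ) * f y =
      ∑ y, ((avail y).card : ℝ) * f y + (B.card - (avail x).card) * f x := by
  rw [← Finset.add_sum_erase _ _ (Finset.mem_univ x),
    ← Finset.add_sum_erase _ (fun y => ((avail y).card : ℝ) * f y) (Finset.mem_univ x),
    Finset.sum_congr rfl fun y hy => by
      rw [Function.update_of_ne (Finset.ne_of_mem_erase hy)],
    Function.update_self]
  ring

variable (Sin : SingleAgentAlgorithm X) (ρ : RemovalRule A X) (ω : Sin.Seed) (st : MulState X C)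

theorem mulTotal_mulRead : mulTotal f (mulRead Sin ρ ω st) = mulTotal f st := by
  classical
  by_cases hs : (st.avail st.cur).Nonempty
  · have hcard := Finset.card_erase_add_one (ρ C st.hist.length st.cur (st.avail st.cur) hs).2
    simp only [mulTotal, mulRead, hs, dif_pos, List.map_append, List.map_cons, List.map_nil,
      List.sum_append, List.sum_singleton]
    rw [sum_card_update_mul, ← hcard]
    push_cast
    ring
  · rw [mulRead, dif_neg hs]

theorem mulTotal_mulDrain : mulTotal f (mulDrain Sin ρ ω st) = mulTotal f st := by
  rw [mulDrain]
  generalize mulBufferSize st = k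
  induction k with
  | zero => rfl
  | succ k ih => rw [Function.iterate_succ_apply', mulTotal_mulRead, ih]

variable {st} in
theorem mulTotal_mulReplenish (hempty : st.avail st.cur = ∅) (y : C → ℝ) :
    mulTotal f (mulReplenish st y) = mulTotal f st + C.card * f st.cur := by
  simp only [mulTotal, mulReplenish]
  rw [sum_card_update_mul, hempty, Finset.card_univ, Fintype.card_coe, Finset.card_empty]
  push_cast
  ring

end MulTotal

theorem abs_sum_range_add_sub_sum_range_le {X : Type*} [Fintype X] {f : X → ℝ} {δ : ℝ}
    (hf : ∀ x, 0 ≤ f x) (hfδ : ∀ x, f x ≤ δ) (x : ℕ → X) (n : X → ℕ) (s : ℕ) :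
    |(∑ r ∈ Finset.range s, f (x r) + ∑ y, n y * f y) -
      ∑ r ∈ Finset.range (s + ∑ y, n y), f (x r)| ≤ ((∑ y, n y : ℕ) : ℝ) * δ := by
  have hleft : ∑ y, n y * f y ≤ ((∑ y, n y : ℕ) : ℝ) * δ := by
    rw [Nat.cast_sum, Finset.sum_mul]
    gcongr with y
    exact hfδ y
  have hright : ∑ r ∈ Finset.range (∑ y, n y), f (x (s + r)) ≤ ((∑ y, n y : ℕ) : ℝ) * δ := by
    simpa using Finset.sum_le_card_nsmul (Finset.range (∑ y, n y)) _ δ fun r _ => hfδ (x (s + r))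
  rw [Finset.sum_range_add, add_sub_add_left_eq_sub]
  exact abs_sub_le_of_nonneg_of_le
    (Finset.sum_nonneg fun y _ => mul_nonneg (n y).cast_nonneg (hf y)) hleft
    (Finset.sum_nonneg fun r _ => hf _) hright

variable (I : FixedInstance d) (Sin : SingleAgentAlgorithm I.X) (ρ : RemovalRule A I.X)
  (C : Finset A) (p : Sin.Seed × (A × ℕ → ℝ))

theorem mulTotal_mulStateAt (f : I.X → ℝ) (T : ℕ) :
    mulTotal f (mulStateAt I Sin ρ C p T) =
      C.card * ∑ t ∈ Finset.range T, f (mulStateAt I Sin ρ C p t).cur := by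
  induction T with
  | zero => simp [mulTotal, mulStateAt, mulState, coalitionHistory, mulInit]
  | succ T ih =>
    rw [mulStateAt_succ, mulTotal_mulDrain,
      mulTotal_mulReplenish f (mulStateAt_avail_cur I Sin ρ C p T), ih,
      Finset.sum_range_succ, mul_add]

variable [Nonempty C]

theorem sum_map_simHistory (f : I.X → ℝ) (s : ℕ) :
    ((simHistory I Sin ρ C p s).map fun u => f u.1).sum =
      ∑ r ∈ Finset.range s, f (simAction I Sin ρ C p r) := by
  induction s with
  | zero => rfl
  | succ s ih =>
    rw [simHistory_succ, List.map_append, List.sum_append, ih, Finset.sum_range_succ,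
      List.map_singleton, List.sum_singleton]

theorem exists_card_mul_sum_cur_eq (T : ℕ) :
    ∃ (s : ℕ) (n : I.X → ℕ), (∀ y, n y ≤ C.card) ∧ ∀ f : I.X → ℝ,
      C.card * ∑ t ∈ Finset.range T, f (mulStateAt I Sin ρ C p t).cur =
        ∑ r ∈ Finset.range s, f (simAction I Sin ρ C p r) + ∑ y, n y * f y := by
  obtain ⟨s, hfollows, -⟩ := exists_follows_mulStateAt I Sin ρ C p T
  refine ⟨s, fun y => ((mulStateAt I Sin ρ C p T).avail y).card,
    fun y => (Finset.card_le_univ _).trans_eq (Fintype.card_coe C), fun f => ?_⟩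
  rw [← mulTotal_mulStateAt, mulTotal, hfollows.hist, sum_map_simHistory]

end Conservation

namespace FixedInstance

variable {d : ℕ} (I : FixedInstance d)

/-- The sub-optimality gap of an action. -/
def gap (x : I.X) : ℝ := I.optReward - I.meanReward x

theorem gap_nonneg (x : I.X) : 0 ≤ I.gap x := sub_nonneg.mpr (Finset.le_sup' I.meanReward x.2)

theorem gap_le_maxGap (x : I.X) : I.gap x ≤ I.maxGap :=
  Finset.le_sup' (fun x => I.optReward - I.meanReward x) x.2

theorem maxGap_nonneg : 0 ≤ I.maxGap :=
  I.X_nonempty.elim fun x hx => (I.gap_nonneg ⟨x, hx⟩).trans (I.gap_le_maxGap ⟨x, hx⟩)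

end FixedInstance

section Regret

variable {d : ℕ} {A : Type*} (I : FixedInstance d) (Sin : SingleAgentAlgorithm I.X)
  (ρ : RemovalRule A I.X) (C : Finset A)

theorem abs_card_mul_sum_gap_sub_le [Nonempty C] (p : Sin.Seed × (A × ℕ → ℝ)) (T : ℕ) :
    |C.card * ∑ t ∈ Finset.range T, I.gap (mulStateAt I Sin ρ C p t).cur -
      ∑ s ∈ Finset.range (C.card * T), I.gap (simAction I Sin ρ C p s)| ≤
        C.card * ((min I.X.card T : ℕ) * I.maxGap) := by
  obtain ⟨s, n, hn, hsum⟩ := exists_card_mul_sum_cur_eq I Sin ρ C p T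
  have hcount : C.card * T = s + ∑ y, n y := by
    have hone := hsum fun _ => 1
    simp only [Finset.sum_const, Finset.card_range, nsmul_eq_mul, mul_one] at hone
    exact_mod_cast hone
  have hunread : ∑ y, n y ≤ C.card * min I.X.card T := by
    have hcard : ∑ y, n y ≤ I.X.card * C.card := by
      simpa using Finset.sum_le_card_nsmul Finset.univ n C.card fun y _ => hn y
    rw [mul_min_of_nonneg _ _ C.card.zero_le, mul_comm C.card I.X.card]
    exact le_min hcard (hcount ▸ Nat.le_add_left _ _)
  rw [hsum, hcount]
  refine (abs_sum_range_add_sub_sum_range_le I.gap_nonneg I.gap_le_maxGap _ n s).trans ?_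
  rw [← mul_assoc, ← Nat.cast_mul]
  gcongr
  exact I.maxGap_nonneg

section Law

variable {Ω : Type*} [MeasurableSpace Ω] {P : Measure Ω} {g : Ω → I.X}

theorem integrable_comp_action [IsFiniteMeasure P] (hg : Measurable g) (f : I.X → ℝ) :
    Integrable (fun u => f (g u)) P :=
  Integrable.comp_measurable (g := f) Integrable.of_finite hg

theorem integral_gap [IsProbabilityMeasure P] (hg : Measurable g) :
    ∫ u, I.gap (g u) ∂P = I.optReward - ∫ u, I.meanReward (g u) ∂P := by
  simp only [FixedInstance.gap]
  rw [integral_sub (integrable_const _) (integrable_comp_action I hg fun x => I.meanReward x),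
    integral_const, probReal_univ, one_smul]

theorem sum_optReward_sub_integral [IsProbabilityMeasure P] {g : ℕ → Ω → I.X}
    (hg : ∀ t, Measurable (g t)) (T : ℕ) :
    ∑ t ∈ Finset.range T, (I.optReward - ∫ u, I.meanReward (g t u) ∂P) =
      ∫ u, ∑ t ∈ Finset.range T, I.gap (g t u) ∂P := by
  rw [integral_finsetSum _ fun t _ => integrable_comp_action I (hg t) I.gap]
  exact Finset.sum_congr rfl fun t _ => (integral_gap I (hg t)).symm

variable [Countable A] [Nonempty C]

theorem measurable_simAction (s : ℕ) : Measurable fun p => simAction I Sin ρ C p s :=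
  measurable_to_countable' fun y => measurableSet_simActions I Sin ρ C s fun _ x => x = y

theorem measurable_mulStateAt_cur (t : ℕ) :
    Measurable fun p => (mulStateAt I Sin ρ C p t).cur := by
  refine measurable_to_countable' fun y => ?_
  change MeasurableSet {p | (mulStateAt I Sin ρ C p t).cur = y}
  simp only [mulStateAt_cur_eq_iff, Set.ofPred_exists]
  exact .iUnion fun s => measurableSet_simActions I Sin ρ C s fun l x =>
    (bufferState C ρ l).plays = t ∧ (bufferState C ρ l).unread x = ∅ ∧ x = y

theorem singleRegret_eq_integral (N : ℕ) :
    singleRegret I Sin N = ∫ p : Sin.Seed × (A × ℕ → ℝ),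
      ∑ s ∈ Finset.range N, I.gap (simAction I Sin ρ C p s)
        ∂(Sin.seedLaw.prod (Measure.infinitePi fun _ : A × ℕ => I.noise)) := by
  have hnoise := measurePreserving_simNoise I Sin ρ C
  have haction : ∀ s, Measurable fun u : Sin.Seed × (ℕ → ℝ) => singleAction I Sin u.1 u.2 s :=
    fun s => measurable_singleAction measurable_fst fun r _ =>
      (measurable_pi_apply r).comp measurable_snd
  rw [← sum_optReward_sub_integral I (measurable_simAction I Sin ρ C)]
  refine Finset.sum_congr rfl fun s _ => ?_
  simp only [simAction_eq_singleAction]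
  congr 1
  rw [← hnoise.map_eq, integral_map hnoise.measurable.aemeasurable]
  · rfl
  · exact (integrable_comp_action I (haction s) fun x => I.meanReward x).aestronglyMeasurable

theorem neg_collaborationValue_eq_integral (T : ℕ) :
    -collaborationValue I (mulAlgorithm Sin ρ) T C = ∫ p : Sin.Seed × (A × ℕ → ℝ),
      C.card * ∑ t ∈ Finset.range T, I.gap (mulStateAt I Sin ρ C p t).cur
        ∂(Sin.seedLaw.prod (Measure.infinitePi fun _ : A × ℕ => I.noise)) := by
  have hregret (a : C) : regret I (mulAlgorithm Sin ρ) C a T = ∫ p : Sin.Seed × (A × ℕ → ℝ),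
      ∑ t ∈ Finset.range T, I.gap (mulStateAt I Sin ρ C p t).cur
        ∂(Sin.seedLaw.prod (Measure.infinitePi fun _ : A × ℕ => I.noise)) :=
    sum_optReward_sub_integral I (P := Sin.seedLaw.prod (Measure.infinitePi fun _ => I.noise))
      (measurable_mulStateAt_cur I Sin ρ C) T
  rw [collaborationValue, neg_neg, Finset.sum_congr rfl fun a _ => hregret a, Finset.sum_const,
    Finset.card_univ, Fintype.card_coe, nsmul_eq_mul, integral_const_mul]

end Law

theorem abs_collaborationValue_add_singleRegret_le [Countable A] (T : ℕ) :
    |collaborationValue I (mulAlgorithm Sin ρ) T C + singleRegret I Sin (C.card * T)| ≤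
      C.card * ((min I.X.card T : ℕ) * I.maxGap) := by
  rcases C.eq_empty_or_nonempty with rfl | hC
  · simp [collaborationValue, singleRegret]
  have : Nonempty C := hC.to_subtype
  set P := Sin.seedLaw.prod (Measure.infinitePi fun _ : A × ℕ => I.noise)
  rw [← abs_neg, neg_add, ← sub_eq_add_neg, neg_collaborationValue_eq_integral,
    singleRegret_eq_integral I Sin ρ C, ← integral_sub]
  · have hbound := norm_integral_le_of_norm_le_const (μ := P) (.of_forall fun p =>
      (Real.norm_eq_abs _).trans_le (abs_card_mul_sum_gap_sub_le I Sin ρ C p T))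
    rwa [probReal_univ, mul_one, Real.norm_eq_abs] at hbound
  · exact (integrable_finsetSum _ fun t _ =>
      integrable_comp_action I (measurable_mulStateAt_cur I Sin ρ C t) I.gap).const_mul _
  · exact integrable_finsetSum _ fun s _ =>
      integrable_comp_action I (measurable_simAction I Sin ρ C s) I.gap

end Regret

theorem RegretRate.add_add_le_two_mul {R υ : ℕ → ℝ} {n T : ℕ} {c ε δ : ℝ} {K : ℕ}
    (hR : RegretRate R (n * T) υ c ε)
    (hT : ∀ t : ℕ, t + 2 ≤ n * T → √(4 * n * K * δ / υ t) ≤ (T : ℝ)) (hδ : 0 ≤ δ)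
    {k : ℕ} (hk : k + 2 ≤ n) :
    R (k * T) + R ((k + 2) * T) + 4 * (k + 1) * ((min K T : ℕ) * δ) ≤ 2 * R ((k + 1) * T) := by
  rcases T.eq_zero_or_pos with rfl | hTpos
  · simp [two_mul]
  have hlast : k * T + T + T ≤ n * T := by nlinarith
  have hυ := hR.υ_pos (k * T) (by omega)
  have hdrop : R (k * T) + R ((k + 2) * T) + υ (k * T) * T ^ 2 ≤ 2 * R ((k + 1) * T) := by
    have hconcave := hR.strict_concavity (k * T) T T hTpos hTpos hlast
    have hT0 : (0 : ℝ) < T := by exact_mod_cast hTpos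
    rw [discreteDeriv₂, discreteDeriv, discreteDeriv, ← sub_div, div_div,
      div_le_iff₀ (by positivity),
      show k * T + T + T = (k + 2) * T by ring, show k * T + T = (k + 1) * T by ring] at hconcave
    linarith
  have hrate : 4 * n * K * δ ≤ υ (k * T) * T ^ 2 := by
    have hsqrt := (Real.sqrt_le_iff.mp (hT (k * T) (by omega))).2
    rwa [div_le_iff₀' hυ] at hsqrt
  have hbuffers : 4 * (k + 1) * ((min K T : ℕ) * δ) ≤ 4 * n * K * δ := by
    have hkn : ((k + 1 : ℕ) : ℝ) ≤ n := by exact_mod_cast (by omega : k + 1 ≤ n)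
    rw [← mul_assoc]
    push_cast at hkn
    gcongr
    exact min_le_left K T
  linarith

end

theorem mainTheorem3_general {A : Type*} [Fintype A] {d : ℕ} (I : FixedInstance d)
    (Sin : SingleAgentAlgorithm I.X) (ρ : RemovalRule A I.X) (T : ℕ)
    (hSin : ∀ k : ℕ, k + 2 ≤ Fintype.card A →
      singleRegret I Sin (k * T) + singleRegret I Sin ((k + 2) * T) +
          4 * (k + 1) * ((min I.X.card T : ℕ) * I.maxGap) ≤
        2 * singleRegret I Sin ((k + 1) * T)) :
    (core (collaborationValue I (mulAlgorithm Sin ρ) T)).Nonempty ∧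
      shapleyValue (collaborationValue I (mulAlgorithm Sin ρ) T) ∈
        core (collaborationValue I (mulAlgorithm Sin ρ) T) := by
  have hconvex : IsConvexGame (collaborationValue I (mulAlgorithm Sin ρ) T) :=
    .of_abs_add_le (f := fun k => singleRegret I Sin (k * T))
      (fun C => abs_collaborationValue_add_singleRegret_le I Sin ρ C T) hSin
  have hmem := hconvex.shapleyValue_mem_core (by simp [collaborationValue])
  exact ⟨⟨_, hmem⟩, hmem⟩

theorem mainTheorem3 {A : Type*} [Fintype A] {d : ℕ} (I : FixedInstance d)
    (Sin : SingleAgentAlgorithm I.X) (ρ : RemovalRule A I.X) (T : ℕ)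
    (υ : ℕ → ℝ) (c ε : ℝ)
    (hSin : RegretRate (singleRegret I Sin) (Fintype.card A * T) υ c ε)
    (hT : ∀ t : ℕ, t + 2 ≤ Fintype.card A * T →
      √(4 * Fintype.card A * I.X.card * I.maxGap / υ t) ≤ (T : ℝ)) :
    (core (collaborationValue I (mulAlgorithm Sin ρ) T)).Nonempty ∧
      shapleyValue (collaborationValue I (mulAlgorithm Sin ρ) T) ∈
        core (collaborationValue I (mulAlgorithm Sin ρ) T) :=
  mainTheorem3_general I Sin ρ T fun _ hk => hSin.add_add_le_two_mul hT I.maxGap_nonneg hk
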